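/- **Theorem (additive MAC-PIR capacity).** Let $M\ge 1$, $N\ge 2$ and $p\in[0,\tfrac12)$. Consider $N$ replicated non-communicating databases, each storing the same $M$ independent messages $W_1,\dots,W_M$, each uniform on $\mathbb F_2^L$. A retrieval scheme with $t\ge 1$ channel uses consists of the following. To retrieve $W_i$, the user draws queries $Q_1^{[i]},\dots,Q_N^{[i]}$ from a joint distribution that may depend on $i$, independently of the messages. Database $n$ answers with a word $A_n^{[i]}=(X_{n,1}^{[i]},\dots,X_{n,t}^{[i]})\in\mathbb F_2^t$ that is a deterministic function of $Q_n^{[i]}$ and $W_{1:M}$. The user receives $\tilde A^{[i]}=(Y_1^{[i]},\dots,Y_t^{[i]})$ with $$Y_\eta^{[i]}=\sum_{n=1}^N X_{n,\eta}^{[i]}+Z_\eta \pmod 2,$$ where $Z_1,\dots,Z_t$ are i.i.d. $\mathrm{Bernoulli}(p)$, independent of the messages and the queries. The scheme is private if $(Q_n^{[i]},A_n^{[i]},W_{1:M})$ and $(Q_n^{[j]},A_n^{[j]},W_{1:M})$ have the same distribution for every database $n$ and all $i,j\in\{1,\dots,M\}$. A rate $R$ is achievable if there is a sequence of private schemes,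 indexed by the message length $L$ and with $t=t_L$ channel uses, such that $L/t_L\to R$ as $L\to\infty$ and such that the scheme is reliable in the sense that $H(W_i\mid Q_{1:N}^{[i]},\tilde A^{[i]})=o(L)$ for every $i$. The MAC-PIR capacity $C_{\mathrm{PIR}}$ is the supremum of all achievable rates. Then $$C_{\mathrm{PIR}}=1-H(p),\qquad H(p)=-p\log_2 p-(1-p)\log_2(1-p)\quad (0\log_2 0=0).$$ The same holds if reliability is instead understood as follows: for every $i$ there are decoders that recover $W_i$ from $(Q_{1:N}^{[i]},\tilde A^{[i]})$ with error probability tending to $0$ as $L\to\infty$. -/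

import Mathlib

open MeasureTheory ProbabilityTheory Filter Topology Asymptotics

namespace MACPIR

/-- The binary entropy function in bits, `H(p) = -p log₂ p - (1 - p) log₂ (1 - p)`. -/
noncomputable def binaryEntropyBits (p : ℝ) : ℝ :=
  Real.binEntropy p / Real.log 2

/-- The conditional Shannon entropy `H(X | Y)`, in bits, of a random variable `X` with values in a
finite set given a random variable `Y` with values in any measurable space:
`H(X | Y) = E[-∑ x, P(X = x | Y) log₂ P(X = x | Y)]`, where `P(X = · | Y = y)` is the
conditional distribution of `X` given `Y = y`. -/
noncomputable def condEntropy {Ω α β : Type} [MeasurableSpace Ω] [MeasurableSpace α]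
    [MeasurableSpace β] [Fintype α] [Nonempty α] [StandardBorelSpace α]
    (μ : Measure Ω) [IsFiniteMeasure μ] (X : Ω → α) (Y : Ω → β) : ℝ :=
  (∫ y, ∑ x, Real.negMulLog ((condDistrib X Y μ y).real {x}) ∂(μ.map Y)) / Real.log 2

/-- Binary words of length `n`. -/
abbrev Word (n : ℕ) : Type := Fin n → ZMod 2

/-- The contents of a database: `M` messages, each a binary word of length `L`. -/
abbrev Messages (M L : ℕ) : Type := Fin M → Word L

/-- The messages are independent and uniform, so the message tuple is uniform. -/
noncomputable def messageLaw (M L : ℕ) : Measure (Messages M L) :=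
  (PMF.uniformOfFintype (Messages M L)).toMeasure

instance (M L : ℕ) : IsProbabilityMeasure (messageLaw M L) :=
  inferInstanceAs (IsProbabilityMeasure (PMF.uniformOfFintype (Messages M L)).toMeasure)

/-- The law of the noise `(Z_1, …, Z_t)`: independent bits, each equal to `1` with
probability `p`. -/
noncomputable def noiseLaw (p : unitInterval) (t : ℕ) : Measure (Word t) :=
  Measure.pi fun _ => bernoulliMeasure (1 : ZMod 2) 0 p

instance (p : unitInterval) (t : ℕ) : IsProbabilityMeasure (noiseLaw p t) :=
  inferInstanceAs
    (IsProbabilityMeasure (Measure.pi fun _ : Fin t => bernoulliMeasure (1 : ZMod 2) 0 p))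

/-- A retrieval scheme for `M` messages of length `L` and `N` databases. To retrieve message `i`,
the user draws the queries `(Q_1, …, Q_N)` from `queryLaw i`, and database `n`, which sees only
its own query and the messages, returns the word `answer n (Q_n, W_{1:M})` of length `t`. -/
structure Scheme (M N L : ℕ) where
  /-- the common length of the answers, which is the number of channel uses -/
  t : ℕ
  t_pos : 0 < t
  /-- the query alphabets -/
  Query : Fin N → Type
  measurableSpaceQuery : ∀ n, MeasurableSpace (Query n)
  /-- the joint law of the `N` queries when message `i` is desired -/
  queryLaw : Fin M → Measure (∀ n, Query n)
  isProbabilityMeasure_queryLaw : ∀ i, IsProbabilityMeasure (queryLaw i)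
  answer : ∀ n, Query n × Messages M L → Word t
  measurable_answer : ∀ n, Measurable (answer n)

attribute [instance] Scheme.measurableSpaceQuery Scheme.isProbabilityMeasure_queryLaw

namespace Scheme

variable {M N L : ℕ} (S : Scheme M N L)

/-- The tuple of queries. -/
abbrev Queries : Type := ∀ n, S.Query n

/-- The privacy constraint: for each database `n`, the joint law of its query, its answer and
the messages does not depend on the index of the desired message. The messages are independent
of the queries. -/
def IsPrivate : Prop :=
  ∀ (n : Fin N) (i j : Fin M),
    ((messageLaw M L).prod (S.queryLaw i)).map
        (fun ω => (ω.2 n, S.answer n (ω.2 n, ω.1), ω.1)) =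
      ((messageLaw M L).prod (S.queryLaw j)).map
        (fun ω => (ω.2 n, S.answer n (ω.2 n, ω.1), ω.1))

/-- The sample space: messages, queries and channel noise. -/
abbrev Sample : Type := (Messages M L × S.Queries) × Word S.t

/-- The law on the sample space when message `i` is desired: the messages, the queries and the
noise are independent. -/
noncomputable def law (p : unitInterval) (i : Fin M) : Measure S.Sample :=
  ((messageLaw M L).prod (S.queryLaw i)).prod (noiseLaw p S.t)

instance (p : unitInterval) (i : Fin M) : IsProbabilityMeasure (S.law p i) :=
  inferInstanceAs (IsProbabilityMeasure
    (((messageLaw M L).prod (S.queryLaw i)).prod (noiseLaw p S.t)))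

/-- The output of the additive multiple access channel, `Y_η = X_{1,η} + ⋯ + X_{N,η} + Z_η`
modulo 2, where `X_{n,η}` is the symbol number `η` of the answer of database `n`. -/
def channelOutput (ω : S.Sample) : Word S.t :=
  fun η => (∑ n, S.answer n (ω.1.2 n, ω.1.1) η) + ω.2 η

/-- What the user knows after the retrieval: all queries and the channel output. -/
def observation (ω : S.Sample) : S.Queries × Word S.t :=
  (ω.1.2, S.channelOutput ω)

/-- The conditional entropy of the desired message `W_i` given the queries and the
channel output. -/
noncomputable def equivocation (p : unitInterval) (i : Fin M) : ℝ :=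
  condEntropy (S.law p i) (fun ω => ω.1.1 i) S.observation

/-- The probability that `decode`, applied to the queries and the channel output, does not return
the desired message `W_i`. -/
noncomputable def errorProb (p : unitInterval) (i : Fin M)
    (decode : S.Queries × Word S.t → Word L) : ℝ :=
  (S.law p i).real {ω | decode (S.observation ω) ≠ ω.1.1 i}

end Scheme

/-- The retrieval rates that are achievable over the additive multiple access channel with noise
parameter `p`, with the reliability constraint in entropy form: limits `R = lim L / t` along
sequences of private schemes, indexed by the message length `L`, such that
`H(W_i | Q_{1:N}, Y_{1:t}) = o(L)` for every desired message `i`. -/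
def entropyAchievableRates (M N : ℕ) (p : unitInterval) : Set ℝ :=
  {R | ∃ S : ∀ L : ℕ, Scheme M N L,
    (∀ L, (S L).IsPrivate) ∧
    (∀ i, (fun L => (S L).equivocation p i) =o[atTop] (fun L => (L : ℝ))) ∧
    Tendsto (fun L : ℕ => (L : ℝ) / ((S L).t : ℝ)) atTop (𝓝 R)}

/-- The same with the reliability constraint in terms of decoding: for every desired message `i`
there are decoders whose error probability tends to `0` as `L → ∞`. -/
def errorAchievableRates (M N : ℕ) (p : unitInterval) : Set ℝ :=
  {R | ∃ S : ∀ L : ℕ, Scheme M N L,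
    (∀ L, (S L).IsPrivate) ∧
    (∀ i, ∃ decode : ∀ L, (S L).Queries × Word (S L).t → Word L,
      (∀ L, Measurable (decode L)) ∧
      Tendsto (fun L => (S L).errorProb p i (decode L)) atTop (𝓝 0)) ∧
    Tendsto (fun L : ℕ => (L : ℝ) / ((S L).t : ℝ)) atTop (𝓝 R)}

end MACPIR

/-!
The capacity is that of a single binary symmetric channel, because the additive channel lets the
databases hide the request at no cost in rate.

*Achievability.* Let all databases share a linear code over `ZMod 2` with encoder `encode G`. With
a uniformly random word `a`, the first database gets the query `a`, the second one `a + e_i`, and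
all others `0`; on a query `q` a database answers with the codeword of `∑ m, q m • W_m`. Each single
query has a law that does not depend on `i`, while the queries add up to `e_i`, so by linearity the
channel itself adds the answers up to the codeword of `W_i` and the user sees the output of a binary
symmetric channel (`linearScheme`). It remains to see that linear codes achieve the capacity of that
channel (`exists_code_of_lt_capacity`). A uniformly random generator matrix maps a nonzero word to a
uniform word, so decoding to a word that explains the output by a noise pattern in a set `T` fails
with probability at most `P(Z ∉ T) + 2 ^ L * |T| / 2 ^ t` on average (`exists_linear_code`). For `T`
the set of patterns of probability at least `exp (-(t * a))`, with `a` slightly above the entropy of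
a noise bit, one has `|T| ≤ exp (t * a)`, and a Chernoff bound shows that `P(Z ∉ T)` decays
exponentially (`noiseLaw_real_lt_le`, `exists_moment_lt_one`).

*Converse.* Privacy plays no role: given the queries, `W_i` is uniform and the output is
`Y = c(W) + Z` with a function `c` of all messages. Concavity of the entropy gives
`H(Y, W_i) ≥ L + H(Z) = L + t H(p)` (`le_sum_negMulLog_joint`), and `H(Y) ≤ t`, so that
`H(W_i | Q, Y) ≥ L - t (1 - H(p))` (`Scheme.le_equivocation`). Queries may live in arbitrary
measurable spaces, so `le_condEntropy_of_kernel` first identifies the conditional distribution of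
`W_i` with the one obtained from the joint law of `(Y, W_i)` for each fixed value of the queries.
If the left side is `o(L)`, then the limit of `L / t` is at most `1 - H(p)`.

By Fano's inequality (`condEntropy_le_fano`) a vanishing error probability implies an equivocation
of `o(L)`. Hence the converse is needed only for the entropy form of reliability and the
construction only for the error form.
-/

namespace MACPIR

/-! ### Entropy of finite distributions -/

/-- The pointwise form of Gibbs' inequality; summed over a distribution `x` and a
subdistribution `y`, it bounds the entropy of `x` by the cross entropy. -/
lemma negMulLog_le_cross {x y : ℝ} (hx : 0 ≤ x) (hy : 0 < y) :
    Real.negMulLog x ≤ -(x * Real.log y) + y - x := by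
  rcases hx.eq_or_lt with rfl | hx
  · simpa using hy.le
  have h := mul_le_mul_of_nonneg_left (Real.log_le_sub_one_of_pos (div_pos hy hx)) hx.le
  rw [Real.log_div hy.ne' hx.ne', mul_sub, mul_sub, mul_div_cancel₀ _ hx.ne'] at h
  rw [Real.negMulLog]
  linarith

lemma negMulLog_le_one {x : ℝ} (hx : 0 ≤ x) : Real.negMulLog x ≤ 1 := by
  have := negMulLog_le_cross hx one_pos
  simp only [Real.log_one, mul_zero, neg_zero, zero_add] at this
  linarith

/-- The uniform distribution has maximal entropy. -/
lemma sum_negMulLog_le_log_card {α : Type*} [Fintype α] [Nonempty α] {f : α → ℝ}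
    (h0 : ∀ x, 0 ≤ f x) (h1 : ∑ x, f x = 1) :
    ∑ x, Real.negMulLog (f x) ≤ Real.log (Fintype.card α) := by
  have hc : (0 : ℝ) < Fintype.card α := by exact_mod_cast Fintype.card_pos
  calc ∑ x, Real.negMulLog (f x)
      ≤ ∑ x, (-(f x * Real.log (Fintype.card α : ℝ)⁻¹) + (Fintype.card α : ℝ)⁻¹ - f x) :=
        Finset.sum_le_sum fun x _ => negMulLog_le_cross (h0 x) (inv_pos.2 hc)
    _ = Real.log (Fintype.card α) := by
        rw [Finset.sum_sub_distrib, Finset.sum_add_distrib, Finset.sum_neg_distrib,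
          ← Finset.sum_mul, h1, Finset.sum_const, Finset.card_univ, nsmul_eq_mul,
          mul_inv_cancel₀ hc.ne', Real.log_inv]
        ring

/-- Fano's inequality for a single distribution `f` and a guess `d`. -/
lemma sum_negMulLog_le_fano {α : Type*} [Fintype α] {f : α → ℝ}
    (h0 : ∀ x, 0 ≤ f x) (h1 : ∑ x, f x = 1) (d : α) :
    ∑ x, Real.negMulLog (f x) ≤ Real.log 2 + (1 - f d) * Real.log (Fintype.card α) := by
  classical
  have : Nonempty α := ⟨d⟩
  set c : ℝ := (Fintype.card α : ℝ)
  have hc : 0 < c := by simp only [c]; exact_mod_cast Fintype.card_pos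
  have hsum : ∑ x ∈ Finset.univ.erase d, f x = 1 - f d := by
    rw [← h1, ← Finset.add_sum_erase _ f (Finset.mem_univ d)]; ring
  -- The reference distribution puts mass `1 / 2` on `d` and at most `1 / 2` on the other points.
  have hd := negMulLog_le_cross (h0 d) (y := 1 / 2) (by norm_num)
  have hr : ∑ x ∈ Finset.univ.erase d, Real.negMulLog (f x) ≤
      ∑ x ∈ Finset.univ.erase d, (-(f x * Real.log (1 / (2 * c))) + 1 / (2 * c) - f x) :=
    Finset.sum_le_sum fun x _ => negMulLog_le_cross (h0 x) (by positivity)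
  have hcard : (((Finset.univ.erase d).card : ℕ) : ℝ) * (1 / (2 * c)) ≤ 1 / 2 := by
    have : (((Finset.univ.erase d).card : ℕ) : ℝ) ≤ c := by
      simp only [c]; exact_mod_cast Finset.card_le_univ _
    calc _ ≤ c * (1 / (2 * c)) := by gcongr
      _ = 1 / 2 := by field_simp
  rw [Finset.sum_sub_distrib, Finset.sum_add_distrib, Finset.sum_neg_distrib,
    ← Finset.sum_mul, hsum, Finset.sum_const, nsmul_eq_mul, one_div,
    Real.log_inv, Real.log_mul two_ne_zero hc.ne'] at hr
  rw [one_div, Real.log_inv] at hd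
  rw [one_div] at hcard
  rw [← Finset.add_sum_erase _ _ (Finset.mem_univ d)]
  linarith

/-- The chain rule `H(X | Y) = H(Y, X) - H(Y)` on finite alphabets. -/
lemma integral_sum_negMulLog_eq {α β : Type*} [Fintype α] [Fintype β]
    [MeasurableSpace α] [MeasurableSpace β] [MeasurableSingletonClass α]
    [MeasurableSingletonClass β] (ρ : Measure β) [IsProbabilityMeasure ρ] (K : Kernel β α)
    [IsMarkovKernel K] :
    ∫ y, ∑ x, Real.negMulLog ((K y).real {x}) ∂ρ =
      ∑ q, Real.negMulLog ((ρ ⊗ₘ K).real {q}) - ∑ y, Real.negMulLog (ρ.real {y}) := by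
  have hsingle : ∀ y x, (ρ ⊗ₘ K).real {(y, x)} = ρ.real {y} * (K y).real {x} := by
    intro y x
    rw [← Set.singleton_prod_singleton, measureReal_def,
      Measure.compProd_apply_prod (measurableSet_singleton y) (measurableSet_singleton x)]
    simp [measureReal_def, mul_comm]
  have hone : ∀ y, ∑ x, (K y).real {x} = 1 := fun y => by
    rw [sum_measureReal_singleton]; simp
  rw [integral_fintype .of_finite, Fintype.sum_prod_type, ← Finset.sum_sub_distrib]
  refine Finset.sum_congr rfl fun y _ => ?_
  simp only [hsingle, Real.negMulLog_mul, Finset.sum_add_distrib, ← Finset.sum_mul,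
    ← Finset.mul_sum, hone, smul_eq_mul]
  ring

/-- Fano's inequality, with the bound `1` for the binary entropy of the error event. -/
lemma condEntropy_le_fano {Ω α β : Type} [MeasurableSpace Ω] [MeasurableSpace α]
    [MeasurableSpace β] [Fintype α] [Nonempty α] [StandardBorelSpace α]
    (μ : Measure Ω) [IsProbabilityMeasure μ] {X : Ω → α} {Y : Ω → β} (hX : Measurable X)
    (hY : Measurable Y) {d : β → α} (hd : Measurable d) :
    condEntropy μ X Y ≤
      1 + μ.real {ω | d (Y ω) ≠ X ω} * (Real.log (Fintype.card α) / Real.log 2) := by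
  have hlog : 0 < Real.log 2 := Real.log_pos one_lt_two
  have : IsProbabilityMeasure (μ.map Y) := Measure.isProbabilityMeasure_map hY.aemeasurable
  set D := condDistrib X Y μ
  have hone : ∀ y, ∑ x, (D y).real {x} = 1 := fun y => by
    rw [sum_measureReal_singleton]; simp
  have hmeas : MeasurableSet {q : β × α | q.2 ≠ d q.1} :=
    (measurableSet_eq_fun measurable_snd (hd.comp measurable_fst)).compl
  have hsec : ∀ y, Prod.mk y ⁻¹' {q : β × α | q.2 ≠ d q.1} = {d y}ᶜ := by
    intro y; ext x; simp
  have hDm : Measurable fun y => (D y) {d y}ᶜ := by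
    have := Kernel.measurable_kernel_prodMk_left (κ := D) hmeas
    simpa only [hsec] using this
  have hint : Integrable (fun y => (D y).real {d y}ᶜ) (μ.map Y) := by
    refine Integrable.of_bound hDm.ennreal_toReal.aestronglyMeasurable 1 (ae_of_all _ fun y => ?_)
    rw [Real.norm_of_nonneg measureReal_nonneg]
    exact measureReal_le_one
  have herr : ∫ y, (D y).real {d y}ᶜ ∂(μ.map Y) = μ.real {ω | d (Y ω) ≠ X ω} := by
    have h : (μ.map Y ⊗ₘ D) {q : β × α | q.2 ≠ d q.1} = μ {ω | d (Y ω) ≠ X ω} := by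
      rw [compProd_map_condDistrib hX.aemeasurable, Measure.map_apply (hY.prodMk hX) hmeas]
      congr 1; ext ω; simp [eq_comm]
    rw [Measure.compProd_apply hmeas] at h
    simp only [hsec] at h
    rw [measureReal_def, ← h, ← integral_toReal hDm.aemeasurable
      (ae_of_all _ fun y => measure_lt_top _ _)]
    rfl
  have hle : ∫ y, ∑ x, Real.negMulLog ((D y).real {x}) ∂(μ.map Y) ≤
      ∫ y, (Real.log 2 + (D y).real {d y}ᶜ * Real.log (Fintype.card α)) ∂(μ.map Y) := by
    refine integral_mono_of_nonneg (ae_of_all _ fun y => ?_)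
      ((integrable_const _).add (hint.mul_const _)) (ae_of_all _ fun y => ?_)
    · exact Finset.sum_nonneg fun x _ => Real.negMulLog_nonneg measureReal_nonneg measureReal_le_one
    · have := sum_negMulLog_le_fano (fun x => measureReal_nonneg (μ := D y) (s := {x})) (hone y) (d y)
      rwa [← probReal_compl_eq_one_sub (measurableSet_singleton _)] at this
  rw [integral_add (integrable_const _) (hint.mul_const _), integral_mul_const, herr] at hle
  simp only [integral_const, probReal_univ, one_smul] at hle
  rw [condEntropy, div_le_iff₀ hlog]
  refine hle.trans_eq ?_
  field_simp

/-- If the conditional joint distribution of `(Y, X)` given `Q = q` is `κ q`, and `H(Y, X) - H(Y)`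
is at least `c` under every `κ q`, then `H(X | Q, Y)` is at least `c`. -/
lemma le_condEntropy_of_kernel {Ω α β γ : Type} [MeasurableSpace Ω] [MeasurableSpace α]
    [MeasurableSpace β] [MeasurableSpace γ] [Fintype α] [Nonempty α] [MeasurableSingletonClass α]
    [StandardBorelSpace α] [Fintype β] [MeasurableSingletonClass β]
    (μ : Measure Ω) [IsProbabilityMeasure μ] {X : Ω → α} {Y : Ω → β} {Q : Ω → γ}
    (hX : Measurable X) (hY : Measurable Y) (hQ : Measurable Q)
    (ν : Measure γ) [IsProbabilityMeasure ν] (κ : Kernel γ (β × α)) [IsMarkovKernel κ]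
    (hκ : μ.map (fun ω => (Q ω, (Y ω, X ω))) = ν ⊗ₘ κ) (c : ℝ)
    (hc : ∀ q, c ≤ ∑ z, Real.negMulLog ((κ q).real {z}) -
      ∑ y, Real.negMulLog ((κ q).fst.real {y})) :
    c / Real.log 2 ≤ condEntropy μ X (fun ω => (Q ω, Y ω)) := by
  have hlog : 0 < Real.log 2 := Real.log_pos one_lt_two
  have hassoc : ν ⊗ₘ κ =
      ((ν ⊗ₘ κ.fst) ⊗ₘ κ.condKernel).map MeasurableEquiv.prodAssoc := by
    conv_lhs => rw [← Kernel.disintegrate κ κ.condKernel]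
    exact Measure.compProd_assoc'.symm
  have hjoint : μ.map (fun ω => ((Q ω, Y ω), X ω)) = (ν ⊗ₘ κ.fst) ⊗ₘ κ.condKernel := by
    have h := congrArg (Measure.map MeasurableEquiv.prodAssoc.symm) (hκ.trans hassoc)
    rw [Measure.map_map (by fun_prop) (by fun_prop),
      Measure.map_map (by fun_prop) (by fun_prop), MeasurableEquiv.symm_comp_self,
      Measure.map_id] at h
    exact h
  have hmarg : μ.map (fun ω => (Q ω, Y ω)) = ν ⊗ₘ κ.fst := by
    have h := congrArg Measure.fst hjoint
    rwa [Measure.fst_compProd, Measure.fst_map_prodMk hX] at h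
  have hae := condDistrib_ae_eq_of_measure_eq_compProd (fun ω => (Q ω, Y ω)) hX.aemeasurable
    (hmarg ▸ hjoint)
  rw [condEntropy, hmarg]
  rw [hmarg] at hae
  refine div_le_div_of_nonneg_right ?_ hlog.le
  rw [integral_congr_ae (g := fun y => ∑ x, Real.negMulLog ((κ.condKernel y).real {x}))
    (hae.mono fun y hy => by simp only [hy])]
  have hmeas : Measurable fun y => ∑ x, Real.negMulLog ((κ.condKernel y).real {x}) :=
    Finset.measurable_sum _ fun x _ => Real.continuous_negMulLog.measurable.comp
      (Kernel.measurable_coe _ (measurableSet_singleton x)).ennreal_toReal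
  have hbound : ∀ y, ‖∑ x, Real.negMulLog ((κ.condKernel y).real {x})‖ ≤ Fintype.card α := by
    intro y
    rw [Real.norm_of_nonneg (Finset.sum_nonneg fun x _ =>
      Real.negMulLog_nonneg measureReal_nonneg measureReal_le_one)]
    exact (Finset.sum_le_sum fun x _ => negMulLog_le_one measureReal_nonneg).trans_eq (by simp)
  have hint : Integrable (fun y => ∑ x, Real.negMulLog ((κ.condKernel y).real {x}))
      (ν ⊗ₘ κ.fst) :=
    Integrable.of_bound hmeas.aestronglyMeasurable _ (ae_of_all _ hbound)
  rw [Measure.integral_compProd hint]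
  have hinner : ∀ q, c ≤ ∫ y, ∑ x, Real.negMulLog ((κ.condKernel (q, y)).real {x}) ∂(κ.fst q) := by
    intro q
    have h := integral_sum_negMulLog_eq (κ.fst q) (κ.condKernel.sectR q)
    have hq : κ.fst q ⊗ₘ κ.condKernel.sectR q = κ q := by
      conv_rhs => rw [← Kernel.disintegrate κ κ.condKernel]
      exact (Kernel.compProd_apply_eq_compProd_sectR _ _ _).symm
    rw [hq] at h
    refine (hc q).trans_eq ?_
    rw [Measure.fst, ← Kernel.fst_apply]
    exact h.symm
  have hint' : Integrable
      (fun q => ∫ y, ∑ x, Real.negMulLog ((κ.condKernel (q, y)).real {x}) ∂(κ.fst q)) ν :=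
    Integrable.integral_compProd hint
  calc c = ∫ _, c ∂ν := by simp
    _ ≤ _ := integral_mono (integrable_const _) hint' hinner

/-! ### Messages and noise -/

/-- The fibres of a surjective homomorphism of finite groups have equal size. -/
lemma card_fiber_mul_card {G H : Type*} [AddGroup G] [AddGroup H] [Fintype G] [Fintype H]
    [DecidableEq H] (φ : G →+ H) (hφ : Function.Surjective φ) (y : H) :
    (Finset.univ.filter fun g => φ g = y).card * Fintype.card H = Fintype.card G := by
  have h : ∀ z, (Finset.univ.filter fun g => φ g = z).card =
      (Finset.univ.filter fun g => φ g = y).card := fun z =>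
    AddMonoidHom.card_fiber_eq_of_mem_range φ (hφ z) (hφ y)
  have := Finset.card_eq_sum_card_fiberwise (s := (Finset.univ : Finset G)) (t := Finset.univ)
    (f := φ) (fun _ _ => Finset.mem_coe.2 (Finset.mem_univ _))
  simp only [h, Finset.sum_const, smul_eq_mul, Finset.card_univ] at this
  rw [this, mul_comm]

lemma card_word (n : ℕ) : Fintype.card (Word n) = 2 ^ n := by
  simp [Word]

lemma messageLaw_real_singleton (M L : ℕ) (w : Messages M L) :
    (messageLaw M L).real {w} = (Fintype.card (Messages M L) : ℝ)⁻¹ := by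
  rw [messageLaw, measureReal_def, PMF.toMeasure_apply_singleton _ _ (measurableSet_singleton w)]
  simp

lemma card_messages_filter {M L : ℕ} (i : Fin M) (x : Word L) :
    ((Finset.univ.filter fun w : Messages M L => w i = x).card : ℝ) * 2 ^ L =
      Fintype.card (Messages M L) := by
  have h := card_fiber_mul_card (Pi.evalAddMonoidHom (fun _ : Fin M => Word L) i)
    (fun y => ⟨Pi.single i y, by simp⟩) x
  rw [card_word] at h
  exact_mod_cast h

/-- The probability that a noise bit equals `x`. -/
noncomputable def bitProb (p : unitInterval) (x : ZMod 2) : ℝ :=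
  (bernoulliMeasure (1 : ZMod 2) 0 p).real {x}

lemma bitProb_one (p : unitInterval) : bitProb p 1 = p := by
  rw [bitProb, bernoulliMeasure_real_apply p (measurableSet_singleton _)]
  simp

lemma bitProb_zero (p : unitInterval) : bitProb p 0 = 1 - p := by
  rw [bitProb, bernoulliMeasure_real_apply p (measurableSet_singleton _)]
  simp

lemma sum_bit {β : Type*} [AddCommMonoid β] (f : ZMod 2 → β) : ∑ x, f x = f 0 + f 1 :=
  Fin.sum_univ_two f

lemma sum_bitProb (p : unitInterval) : ∑ x, bitProb p x = 1 := by
  rw [sum_bit, bitProb_zero, bitProb_one]; ring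

lemma bitProb_nonneg (p : unitInterval) (x : ZMod 2) : 0 ≤ bitProb p x := measureReal_nonneg

lemma noiseLaw_real_singleton (p : unitInterval) {t : ℕ} (z : Word t) :
    (noiseLaw p t).real {z} = ∏ j, bitProb p (z j) := by
  rw [noiseLaw, measureReal_def, Measure.pi_singleton, ENNReal.toReal_prod]
  rfl

lemma sum_noiseLaw (p : unitInterval) (t : ℕ) : ∑ z, (noiseLaw p t).real {z} = 1 := by
  rw [sum_measureReal_singleton]; simp

/-- Entropy is additive over independent identically distributed symbols. -/
lemma sum_negMulLog_prod {α : Type*} [Fintype α] (b : α → ℝ) (hb : ∑ x, b x = 1) (t : ℕ) :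
    ∑ z : Fin t → α, Real.negMulLog (∏ j, b (z j)) = t * ∑ x, Real.negMulLog (b x) := by
  classical
  induction t with
  | zero => simp
  | succ t ih =>
    have hprod : ∑ z : Fin t → α, ∏ j, b (z j) = 1 := by
      rw [← Fintype.piFinset_univ, ← Finset.prod_univ_sum (fun _ => Finset.univ) (fun _ => b)]
      simp [hb]
    rw [← (Fin.consEquiv fun _ : Fin (t + 1) => α).sum_comp, Fintype.sum_prod_type]
    simp only [Fin.consEquiv_apply, Fin.prod_univ_succ, Fin.cons_zero, Fin.cons_succ,
      Real.negMulLog_mul, Finset.sum_add_distrib, ← Finset.sum_mul, ← Finset.mul_sum, hb, hprod, ih]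
    push_cast
    ring

lemma sum_negMulLog_noiseLaw (p : unitInterval) (t : ℕ) :
    ∑ z, Real.negMulLog ((noiseLaw p t).real {z}) = t * Real.binEntropy p := by
  simp only [noiseLaw_real_singleton]
  rw [sum_negMulLog_prod _ (sum_bitProb p), sum_bit, bitProb_zero, bitProb_one,
    Real.binEntropy_eq_negMulLog_add_negMulLog_one_sub, add_comm]

/-! ### The converse -/

/-- The joint law of the channel output `Y = c(W) + Z` and the message `W_i` is a mixture of
translates of the noise law. -/
lemma joint_real_singleton {M L t : ℕ} (p : unitInterval) (i : Fin M)
    (c : Messages M L → Word t) (y : Word t) (x : Word L) :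
    (((messageLaw M L).prod (noiseLaw p t)).map (fun ω => (c ω.1 + ω.2, ω.1 i))).real {(y, x)} =
      ∑ w with w i = x, (Fintype.card (Messages M L) : ℝ)⁻¹ * (noiseLaw p t).real {y - c w} := by
  have hsec : ∀ w : Messages M L, Prod.mk w ⁻¹' ((fun ω : Messages M L × Word t =>
      (c ω.1 + ω.2, ω.1 i)) ⁻¹' {(y, x)}) = if w i = x then {y - c w} else ∅ := by
    intro w
    ext z
    split_ifs with h
    · simp [h, eq_sub_iff_add_eq']
    · simp [h]
  rw [measureReal_def, Measure.map_apply (measurable_of_finite _) (measurableSet_singleton _),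
    Measure.prod_apply (Set.toFinite _).measurableSet, lintegral_fintype,
    ENNReal.toReal_sum fun w _ => ENNReal.mul_ne_top (measure_ne_top _ _) (measure_ne_top _ _),
    Finset.sum_filter]
  refine Finset.sum_congr rfl fun w _ => ?_
  rw [hsec, ENNReal.toReal_mul, ← measureReal_def, ← measureReal_def, messageLaw_real_singleton]
  split_ifs with h
  · ring
  · simp

/-- For fixed queries, the channel output `Y = c(W) + Z` and the desired message satisfy
`H(Y, W_i) ≥ L + H(Z)`: by concavity, since given `W_i` the law of `Y` is a mixture of translates
of the noise law. -/
lemma le_sum_negMulLog_joint {M L t : ℕ} (p : unitInterval) (i : Fin M)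
    (c : Messages M L → Word t) :
    L * Real.log 2 + t * Real.binEntropy p ≤ ∑ q, Real.negMulLog
      ((((messageLaw M L).prod (noiseLaw p t)).map
        (fun ω => (c ω.1 + ω.2, ω.1 i))).real {q}) := by
  set m : ℝ := (Fintype.card (Messages M L) : ℝ) with hm
  have hm0 : 0 < m := by rw [hm]; exact_mod_cast Fintype.card_pos
  set u : ℝ := (2 ^ L : ℝ)⁻¹ with hu
  have hu0 : 0 < u := by positivity
  have hpow : (2 : ℝ) ^ L * u = 1 := mul_inv_cancel₀ (by positivity)
  have hweight : ∀ x : Word L, ∑ w : Messages M L with w i = x, 2 ^ L * m⁻¹ = 1 := by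
    intro x
    rw [Finset.sum_const, nsmul_eq_mul, ← mul_assoc, card_messages_filter,
      mul_inv_cancel₀ hm0.ne']
  have hnegu : Real.negMulLog u = u * (L * Real.log 2) := by
    rw [Real.negMulLog, hu, Real.log_inv, Real.log_pow]; ring
  -- Concavity, with equal weights on the message tuples whose `i`-th message is `x`.
  have hstep : ∀ (y : Word t) (x : Word L),
      ∑ w : Messages M L with w i = x,
          2 ^ L * m⁻¹ * Real.negMulLog (u * (noiseLaw p t).real {y - c w}) ≤
        Real.negMulLog ((((messageLaw M L).prod (noiseLaw p t)).map
          (fun ω => (c ω.1 + ω.2, ω.1 i))).real {(y, x)}) := by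
    intro y x
    have h := Real.concaveOn_negMulLog.le_map_sum
      (t := Finset.univ.filter fun w : Messages M L => w i = x)
      (w := fun _ => 2 ^ L * m⁻¹) (p := fun w => u * (noiseLaw p t).real {y - c w})
      (fun w _ => by positivity) (hweight x)
      (fun w _ => mul_nonneg hu0.le measureReal_nonneg)
    simp only [smul_eq_mul] at h
    refine h.trans_eq ?_
    rw [joint_real_singleton]
    congr 1
    refine Finset.sum_congr rfl fun w _ => ?_
    linear_combination m⁻¹ * (noiseLaw p t).real {y - c w} * hpow
  have hsum : ∀ w : Messages M L,
      ∑ y, Real.negMulLog (u * (noiseLaw p t).real {y - c w}) =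
        u * (L * Real.log 2 + t * Real.binEntropy p) := by
    intro w
    have hshift := (Equiv.subRight (c w)).sum_comp
      (fun y => Real.negMulLog (u * (noiseLaw p t).real {y}))
    simp only [Equiv.subRight_apply] at hshift
    rw [hshift]
    simp only [Real.negMulLog_mul, Finset.sum_add_distrib, ← Finset.sum_mul, ← Finset.mul_sum,
      sum_noiseLaw, sum_negMulLog_noiseLaw, hnegu]
    ring
  rw [Fintype.sum_prod_type_right]
  calc L * Real.log 2 + t * Real.binEntropy p
      = ∑ x : Word L, u * (L * Real.log 2 + t * Real.binEntropy p) := by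
        rw [Finset.sum_const, Finset.card_univ, card_word, nsmul_eq_mul]
        push_cast
        linear_combination -(L * Real.log 2 + t * Real.binEntropy p) * hpow
    _ = ∑ x : Word L, ∑ y, ∑ w : Messages M L with w i = x,
          2 ^ L * m⁻¹ * Real.negMulLog (u * (noiseLaw p t).real {y - c w}) := by
        refine Finset.sum_congr rfl fun x _ => ?_
        rw [Finset.sum_comm]
        have hin : ∀ w : Messages M L, ∑ y, 2 ^ L * m⁻¹ *
            Real.negMulLog (u * (noiseLaw p t).real {y - c w}) =
            2 ^ L * m⁻¹ * (u * (L * Real.log 2 + t * Real.binEntropy p)) := fun w => by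
          rw [← Finset.mul_sum, hsum]
        rw [Finset.sum_congr rfl fun w _ => hin w, ← Finset.sum_mul, hweight, one_mul]
    _ ≤ _ := Finset.sum_le_sum fun x _ => Finset.sum_le_sum fun y _ => hstep y x

namespace Scheme

variable {M N L : ℕ} (S : Scheme M N L)

/-- The sum of the answers, as a function of the queries and the messages. -/
def answerSum (q : S.Queries) (w : Messages M L) : Word S.t :=
  ∑ n, S.answer n (q n, w)

lemma measurable_answerSum : Measurable fun x : S.Queries × Messages M L => S.answerSum x.1 x.2 :=
  Finset.measurable_sum _ fun n _ => (S.measurable_answer n).comp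
    (((measurable_pi_apply n).comp measurable_fst).prodMk measurable_snd)

lemma channelOutput_eq (ω : S.Sample) :
    S.channelOutput ω = S.answerSum ω.1.2 ω.1.1 + ω.2 := by
  ext η
  simp [channelOutput, answerSum]

lemma measurable_channelOutput : Measurable S.channelOutput := by
  simp only [funext S.channelOutput_eq]
  exact (S.measurable_answerSum.comp (measurable_fst.snd.prodMk measurable_fst.fst)).add
    measurable_snd

lemma measurable_observation : Measurable S.observation :=
  measurable_fst.snd.prodMk S.measurable_channelOutput

/-- The conditional law of the channel output and the desired message, given the queries. -/
noncomputable def outputKernel (p : unitInterval) (i : Fin M) :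
    Kernel S.Queries (Word S.t × Word L) :=
  (Kernel.id ×ₖ Kernel.const _ ((messageLaw M L).prod (noiseLaw p S.t))).map
    fun x => (S.answerSum x.1 x.2.1 + x.2.2, x.2.1 i)

lemma measurable_output (i : Fin M) :
    Measurable fun x : S.Queries × (Messages M L × Word S.t) =>
      (S.answerSum x.1 x.2.1 + x.2.2, x.2.1 i) :=
  ((S.measurable_answerSum.comp (measurable_fst.prodMk measurable_snd.fst)).add
    measurable_snd.snd).prodMk ((measurable_pi_apply i).comp measurable_snd.fst)

instance (p : unitInterval) (i : Fin M) : IsMarkovKernel (S.outputKernel p i) :=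
  Kernel.IsMarkovKernel.map _ (S.measurable_output i)

lemma outputKernel_apply (p : unitInterval) (i : Fin M) (q : S.Queries) :
    S.outputKernel p i q = ((messageLaw M L).prod (noiseLaw p S.t)).map
      fun ω => (S.answerSum q ω.1 + ω.2, ω.1 i) := by
  rw [outputKernel, Kernel.map_apply _ (S.measurable_output i), Kernel.prod_apply,
    Kernel.id_apply, Kernel.const_apply, Measure.dirac_prod,
    Measure.map_map (S.measurable_output i) measurable_prodMk_left]
  rfl

/-- Disintegration of the law of queries, channel output and message along the queries. -/
lemma map_law_eq_compProd (p : unitInterval) (i j : Fin M) :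
    (S.law p i).map (fun ω => (ω.1.2, (S.channelOutput ω, ω.1.1 j))) =
      S.queryLaw i ⊗ₘ S.outputKernel p j := by
  have hpres : MeasurePreserving (fun ω : S.Sample => (ω.1.2, (ω.1.1, ω.2))) (S.law p i)
      ((S.queryLaw i).prod ((messageLaw M L).prod (noiseLaw p S.t))) :=
    (measurePreserving_prodAssoc _ _ _).comp
      ((Measure.measurePreserving_swap (μ := messageLaw M L) (ν := S.queryLaw i)).prod
        (MeasurePreserving.id (noiseLaw p S.t)))
  ext s hs
  rw [Measure.compProd_apply hs]
  simp only [outputKernel_apply]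
  have hsec : ∀ q, (((messageLaw M L).prod (noiseLaw p S.t)).map
      fun ω => (S.answerSum q ω.1 + ω.2, ω.1 j)) (Prod.mk q ⁻¹' s) =
      ((messageLaw M L).prod (noiseLaw p S.t)) (Prod.mk q ⁻¹'
        ((fun x : S.Queries × (Messages M L × Word S.t) =>
          (x.1, (S.answerSum x.1 x.2.1 + x.2.2, x.2.1 j))) ⁻¹' s)) := by
    intro q
    exact Measure.map_apply ((S.measurable_output j).comp measurable_prodMk_left)
      (measurable_prodMk_left hs)
  have hf : Measurable fun x : S.Queries × (Messages M L × Word S.t) =>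
      (x.1, (S.answerSum x.1 x.2.1 + x.2.2, x.2.1 j)) :=
    measurable_fst.prodMk (S.measurable_output j)
  simp only [hsec]
  rw [← Measure.prod_apply (hf hs), ← hpres.map_eq,
    Measure.map_apply hpres.measurable (hf hs), Measure.map_apply ?_ hs]
  · simp only [channelOutput_eq]
    rfl
  · exact measurable_fst.snd.prodMk (S.measurable_channelOutput.prodMk
      ((measurable_pi_apply j).comp measurable_fst.fst))

/-- The converse bound: `L - H(W_i | Q, Y) = I(W_i ; Y | Q) ≤ t (1 - H(p))`. -/
lemma le_equivocation (p : unitInterval) (i : Fin M) :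
    (L : ℝ) - S.t * (1 - binaryEntropyBits p) ≤ S.equivocation p i := by
  have hlog : 0 < Real.log 2 := Real.log_pos one_lt_two
  have h := le_condEntropy_of_kernel (S.law p i) (X := fun ω => ω.1.1 i)
    (Y := S.channelOutput) (Q := fun ω => ω.1.2)
    ((measurable_pi_apply i).comp measurable_fst.fst) S.measurable_channelOutput
    measurable_fst.snd (S.queryLaw i) (S.outputKernel p i) (S.map_law_eq_compProd p i i)
    (L * Real.log 2 + S.t * Real.binEntropy p - S.t * Real.log 2) (by
      intro q
      have h1 := le_sum_negMulLog_joint p i (S.answerSum q)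
      rw [← outputKernel_apply] at h1
      have h2 := sum_negMulLog_le_log_card
        (f := fun y : Word S.t => (S.outputKernel p i q).fst.real {y})
        (fun _ => measureReal_nonneg) (by rw [sum_measureReal_singleton]; simp)
      rw [card_word, Nat.cast_pow, Real.log_pow, Nat.cast_ofNat] at h2
      linarith)
  refine le_trans (le_of_eq ?_) h
  rw [binaryEntropyBits]
  field_simp
  ring

end Scheme

/-! ### Linear codes for the binary symmetric channel -/

/-- The linear encoder with generator matrix `G`, whose rows are `G k`. -/
def encode {L t : ℕ} (G : Fin L → Word t) : Word L →+ Word t where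
  toFun x := ∑ k, x k • G k
  map_zero' := by simp
  map_add' x y := by simp [add_smul, Finset.sum_add_distrib]

/-- A nonzero word is encoded to a uniformly distributed word by a uniformly random generator
matrix. -/
lemma card_encode_eq {L t : ℕ} {x : Word L} (hx : x ≠ 0) (y : Word t) :
    ((Finset.univ.filter fun G : Fin L → Word t => encode G x = y).card : ℝ) * 2 ^ t =
      Fintype.card (Fin L → Word t) := by
  obtain ⟨k, hk⟩ := Function.ne_iff.1 hx
  let φ : (Fin L → Word t) →+ Word t :=
    { toFun := fun G => encode G x
      map_zero' := by simp [encode]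
      map_add' := fun G G' => by simp [encode, smul_add, Finset.sum_add_distrib] }
  have hφ : Function.Surjective φ := fun v => by
    refine ⟨Pi.single k ((x k)⁻¹ • v), ?_⟩
    change ∑ l, x l • (Pi.single k ((x k)⁻¹ • v) : Fin L → Word t) l = v
    rw [Finset.sum_eq_single k (fun l _ hl => by simp [hl]) (by simp), Pi.single_eq_same,
      smul_inv_smul₀ hk]
  have h := card_fiber_mul_card φ hφ y
  rw [card_word] at h
  exact_mod_cast h

/-- The average over all generator matrices of the probability that a given nonzero codeword
carries the noise into `T` is `|T| / 2 ^ t`. -/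
lemma sum_real_add_encode_mem {L t : ℕ} (ν : Measure (Word t)) [IsProbabilityMeasure ν]
    (T : Finset (Word t)) {x : Word L} (hx : x ≠ 0) :
    (∑ G : Fin L → Word t, ν.real {z | z + encode G x ∈ T}) * 2 ^ t =
      T.card * Fintype.card (Fin L → Word t) := by
  have h1 : ∀ G : Fin L → Word t,
      ν.real {z | z + encode G x ∈ T} = ∑ v ∈ T, ν.real {v - encode G x} := by
    intro G
    rw [← Finset.sum_image (s := T) (g := fun v => v - encode G x) (f := fun v => ν.real {v})
      (fun a _ b _ h => sub_left_injective h), sum_measureReal_singleton]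
    congr 1
    ext z
    simp [sub_eq_iff_eq_add]
  have h2 : ∀ v : Word t, (∑ G : Fin L → Word t, ν.real {v - encode G x}) * 2 ^ t =
      Fintype.card (Fin L → Word t) := by
    intro v
    have hone : ∑ y, ν.real {v - y} = 1 := by
      have := (Equiv.subLeft v).sum_comp (fun y => ν.real {y})
      simp only [Equiv.subLeft_apply] at this
      rw [this, sum_measureReal_singleton]; simp
    rw [← Finset.sum_fiberwise_of_maps_to' (s := Finset.univ) (t := Finset.univ)
      (g := fun G : Fin L → Word t => encode G x) (fun _ _ => Finset.mem_univ _)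
      (fun y => ν.real {v - y}), Finset.sum_mul]
    simp_rw [Finset.sum_const, nsmul_eq_mul, mul_right_comm _ _ ((2 : ℝ) ^ t), card_encode_eq hx]
    rw [← Finset.mul_sum, hone, mul_one]
  simp_rw [h1]
  rw [Finset.sum_comm, Finset.sum_mul]
  simp_rw [h2]
  rw [Finset.sum_const, nsmul_eq_mul]

/-- Random coding: for every set `T` of noise patterns there is a linear code that corrects the
patterns in `T` up to a probability of confusion of at most `2 ^ L * |T| / 2 ^ t`. -/
lemma exists_linear_code {L t : ℕ} (ν : Measure (Word t)) [IsProbabilityMeasure ν]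
    (T : Finset (Word t)) :
    ∃ (G : Fin L → Word t) (D : Word t → Word L), ∀ x,
      ν.real {z | D (encode G x + z) ≠ x} ≤
        ν.real {z | z ∉ T} + 2 ^ L * T.card / 2 ^ t := by
  classical
  -- Some generator matrix is at least as good as the average.
  obtain ⟨G, -, hG⟩ : ∃ G ∈ (Finset.univ : Finset (Fin L → Word t)),
      ∑ u : Word L with u ≠ 0, ν.real {z | z + encode G u ∈ T} ≤ 2 ^ L * T.card / 2 ^ t := by
    refine Finset.exists_le_of_sum_le Finset.univ_nonempty ?_
    rw [Finset.sum_comm, Finset.sum_const, Finset.card_univ, nsmul_eq_mul]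
    have h : ∀ u ∈ Finset.univ.filter fun u : Word L => u ≠ 0,
        ∑ G : Fin L → Word t, ν.real {z | z + encode G u ∈ T} =
          T.card * Fintype.card (Fin L → Word t) / 2 ^ t := by
      intro u hu
      rw [eq_div_iff (by positivity)]
      exact sum_real_add_encode_mem ν T (Finset.mem_filter.1 hu).2
    rw [Finset.sum_congr rfl h, Finset.sum_const, nsmul_eq_mul]
    have hcard : ((Finset.univ.filter fun u : Word L => u ≠ 0).card : ℝ) ≤ 2 ^ L := by
      have := Finset.card_le_univ (Finset.univ.filter fun u : Word L => u ≠ 0)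
      rw [card_word] at this
      exact_mod_cast this
    calc _ ≤ 2 ^ L * (T.card * Fintype.card (Fin L → Word t) / 2 ^ t : ℝ) := by gcongr
      _ = _ := by ring
  -- The decoder returns some word whose codeword differs from `y` by a pattern in `T`.
  let D : Word t → Word L := fun y =>
    if h : ∃ x, y - encode G x ∈ T then h.choose else 0
  refine ⟨G, D, fun x => ?_⟩
  have hsub : {z | D (encode G x + z) ≠ x} ⊆
      {z | z ∉ T} ∪ ⋃ u ∈ Finset.univ.filter fun u : Word L => u ≠ 0,
        {z | z + encode G u ∈ T} := by
    intro z hz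
    by_cases hzT : z ∈ T
    · right
      have h : ∃ x', encode G x + z - encode G x' ∈ T := ⟨x, by simpa using hzT⟩
      have hD : D (encode G x + z) = h.choose := dif_pos h
      have hne : h.choose ≠ x := hD ▸ hz
      refine Set.mem_biUnion (x := x - h.choose)
        (by simpa [sub_eq_zero] using hne.symm) ?_
      have := h.choose_spec
      rw [Set.mem_ofPred_eq, map_sub]
      convert this using 1
      abel
    · exact Or.inl hzT
  calc ν.real {z | D (encode G x + z) ≠ x}
      ≤ _ := measureReal_mono hsub
    _ ≤ _ := measureReal_union_le _ _
    _ ≤ _ := add_le_add_right ((measureReal_biUnion_finset_le _ _).trans hG) _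

/-- The contribution `b ^ (1 - s) = b * exp (s * (-log b))` of a symbol of probability `b` to the
moment generating function of the information has derivative `-b log b` at `s = 0`. This includes
`b = 0`, where the contribution vanishes for all `s ≠ 1`. -/
lemma hasDerivAt_rpow_one_sub {b : ℝ} (hb : 0 ≤ b) :
    HasDerivAt (fun s : ℝ => b ^ (1 - s)) (Real.negMulLog b) 0 := by
  rcases hb.eq_or_lt with rfl | hb
  · rw [Real.negMulLog_zero]
    refine (hasDerivAt_const (0 : ℝ) (0 : ℝ)).congr_of_eventuallyEq ?_
    filter_upwards [gt_mem_nhds (zero_lt_one (α := ℝ))] with s hs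
    exact Real.zero_rpow (sub_pos.2 hs).ne'
  · have h := ((hasDerivAt_id (0 : ℝ)).const_sub 1).const_rpow hb
    refine h.congr_deriv ?_
    simp [Real.negMulLog]
    ring

/-- A Chernoff bound: at `s = 0` the expression equals `1` and its derivative is
`binEntropy p - a`, which is negative. -/
lemma exists_moment_lt_one (p : unitInterval) {a : ℝ} (ha : Real.binEntropy p < a) :
    ∃ s : ℝ, 0 < s ∧ (∑ x, bitProb p x ^ (1 - s)) * Real.exp (-(a * s)) < 1 := by
  have hB : HasDerivAt (fun s : ℝ => ∑ x, bitProb p x ^ (1 - s)) (Real.binEntropy p) 0 := by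
    have h := HasDerivAt.fun_sum (u := Finset.univ)
      fun x _ => hasDerivAt_rpow_one_sub (bitProb_nonneg p x)
    rwa [sum_bit, bitProb_zero, bitProb_one, add_comm,
      ← Real.binEntropy_eq_negMulLog_add_negMulLog_one_sub] at h
  have hE : HasDerivAt (fun s : ℝ => Real.exp (-(a * s))) (-a) 0 := by
    have h := (((hasDerivAt_id (0 : ℝ)).const_mul a).neg).exp
    simpa using h
  have hg := hB.mul hE
  simp only [mul_zero, neg_zero, Real.exp_zero, sub_zero, Real.rpow_one, sum_bitProb] at hg
  have hlt := (hasDerivAt_iff_tendsto_slope.1 hg).eventually_lt_const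
    (show Real.binEntropy p * 1 + 1 * -a < 0 by linarith)
  have hlt' := hlt.filter_mono (nhdsWithin_mono 0 fun s (hs : s ∈ Set.Ioi (0 : ℝ)) => hs.ne')
  obtain ⟨s, hs, hs0⟩ := (hlt'.and self_mem_nhdsWithin).exists
  refine ⟨s, hs0, ?_⟩
  rw [slope_def_field, div_neg_iff] at hs
  have hs1 : (0 : ℝ) < s - 0 := by simpa using hs0
  rcases hs with ⟨-, h⟩ | ⟨h, -⟩
  · linarith
  · simpa [sum_bitProb] using h

/-- Atypical noise is exponentially unlikely, by Markov's inequality for the `s`-th moment. -/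
lemma noiseLaw_real_lt_le (p : unitInterval) (t : ℕ) (a : ℝ) {s : ℝ} (hs : 0 < s) :
    (noiseLaw p t).real {z | (noiseLaw p t).real {z} < Real.exp (-(t * a))} ≤
      ((∑ x, bitProb p x ^ (1 - s)) * Real.exp (-(a * s))) ^ t := by
  classical
  have hset : {z | (noiseLaw p t).real {z} < Real.exp (-(t * a))} =
      ((Finset.univ.filter fun z => (noiseLaw p t).real {z} < Real.exp (-(t * a)) :
        Finset (Word t)) : Set (Word t)) := by ext; simp
  have hsum : ∑ z : Word t, (noiseLaw p t).real {z} ^ (1 - s) =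
      (∑ x, bitProb p x ^ (1 - s)) ^ t := by
    simp_rw [noiseLaw_real_singleton,
      ← Real.finsetProd_rpow _ _ (fun _ _ => bitProb_nonneg p _)]
    rw [← Fintype.piFinset_univ,
      ← Finset.prod_univ_sum (fun _ => Finset.univ) (fun _ x => bitProb p x ^ (1 - s))]
    simp
  rw [hset, ← sum_measureReal_singleton, mul_pow, ← hsum, ← Real.exp_nat_mul, Finset.sum_mul]
  calc _ ≤ ∑ z : Word t with (noiseLaw p t).real {z} < Real.exp (-(t * a)),
        (noiseLaw p t).real {z} ^ (1 - s) * Real.exp (t * -(a * s)) := by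
        refine Finset.sum_le_sum fun z hz => ?_
        have hz := (Finset.mem_filter.1 hz).2
        rcases (measureReal_nonneg (μ := noiseLaw p t) (s := {z})).eq_or_lt with h0 | h0
        · rw [← h0]; positivity
        · calc (noiseLaw p t).real {z}
              = (noiseLaw p t).real {z} ^ (1 - s) * (noiseLaw p t).real {z} ^ s := by
                rw [← Real.rpow_add h0]; simp
            _ ≤ (noiseLaw p t).real {z} ^ (1 - s) * Real.exp (-(t * a)) ^ s := by gcongr
            _ = _ := by rw [← Real.exp_mul]; congr 2; ring
    _ ≤ _ := Finset.sum_le_sum_of_subset_of_nonneg (Finset.filter_subset _ _)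
        fun z _ _ => by positivity

/-- Below capacity, the binary symmetric channel has linear codes whose error probability decays
exponentially, uniformly over the messages. -/
lemma exists_code_of_lt_capacity (p : unitInterval) {R : ℝ} (hR : R < 1 - binaryEntropyBits p) :
    ∃ r : ℝ, 0 ≤ r ∧ r < 1 ∧ ∀ L t : ℕ, (L : ℝ) ≤ R * t →
      ∃ (G : Fin L → Word t) (D : Word t → Word L), ∀ x,
        (noiseLaw p t).real {z | D (encode G x + z) ≠ x} ≤ 2 * r ^ t := by
  classical
  have hlog : 0 < Real.log 2 := Real.log_pos one_lt_two
  have hR' : Real.binEntropy p < Real.log 2 - R * Real.log 2 := by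
    have h := mul_lt_mul_of_pos_right hR hlog
    rw [binaryEntropyBits, sub_mul, div_mul_cancel₀ _ hlog.ne'] at h
    linarith
  obtain ⟨a, ha, haR⟩ := exists_between hR'
  obtain ⟨s, hs, hs1⟩ := exists_moment_lt_one p ha
  set r₁ := (∑ x, bitProb p x ^ (1 - s)) * Real.exp (-(a * s))
  set r₂ := Real.exp (R * Real.log 2 + a - Real.log 2)
  have hr₁ : 0 ≤ r₁ := mul_nonneg
    (Finset.sum_nonneg fun x _ => Real.rpow_nonneg (bitProb_nonneg p x) _) (Real.exp_pos _).le
  refine ⟨max r₁ r₂, le_max_of_le_left hr₁,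
    max_lt hs1 (Real.exp_lt_one_iff.2 (by linarith)), fun L t hLt => ?_⟩
  -- The typical noise patterns: each has probability at least `exp (-(t * a))`.
  let T : Finset (Word t) :=
    Finset.univ.filter fun z => Real.exp (-(t * a)) ≤ (noiseLaw p t).real {z}
  have hT : (T.card : ℝ) ≤ Real.exp (t * a) := by
    have h : (T.card : ℝ) * Real.exp (-(t * a)) ≤ 1 := by
      calc (T.card : ℝ) * Real.exp (-(t * a)) = ∑ z ∈ T, Real.exp (-(t * a)) := by
            rw [Finset.sum_const, nsmul_eq_mul]
        _ ≤ ∑ z ∈ T, (noiseLaw p t).real {z} :=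
            Finset.sum_le_sum fun z hz => (Finset.mem_filter.1 hz).2
        _ = (noiseLaw p t).real T := sum_measureReal_singleton _
        _ ≤ 1 := measureReal_le_one
    rwa [Real.exp_neg, ← div_eq_mul_inv, div_le_one (Real.exp_pos _)] at h
  obtain ⟨G, D, hD⟩ := exists_linear_code (L := L) (noiseLaw p t) T
  refine ⟨G, D, fun x => (hD x).trans ?_⟩
  have h1 : (noiseLaw p t).real {z | z ∉ T} ≤ r₁ ^ t := by
    have : {z | z ∉ T} = {z | (noiseLaw p t).real {z} < Real.exp (-(t * a))} := by
      ext z; simp [T]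
    rw [this]
    exact noiseLaw_real_lt_le p t a hs
  have h2 : (2 : ℝ) ^ L * T.card / 2 ^ t ≤ r₂ ^ t := by
    have hpow : ∀ n : ℕ, (2 : ℝ) ^ n = Real.exp (n * Real.log 2) := fun n => by
      rw [Real.exp_nat_mul, Real.exp_log two_pos]
    calc (2 : ℝ) ^ L * T.card / 2 ^ t ≤ 2 ^ L * Real.exp (t * a) / 2 ^ t := by gcongr
      _ = Real.exp (L * Real.log 2 + t * a - t * Real.log 2) := by
        rw [hpow, hpow, Real.exp_sub, Real.exp_add]
      _ ≤ Real.exp (t * (R * Real.log 2 + a - Real.log 2)) := by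
        refine Real.exp_le_exp.2 ?_
        linarith [mul_le_mul_of_nonneg_right hLt hlog.le]
      _ = r₂ ^ t := Real.exp_nat_mul _ _
  have h3 : r₁ ^ t ≤ max r₁ r₂ ^ t := by gcongr; exact le_max_left _ _
  have h4 : r₂ ^ t ≤ max r₁ r₂ ^ t := by gcongr; exact le_max_right _ _
  linarith

/-! ### The retrieval scheme -/

namespace Scheme

variable {M N L : ℕ} (S : Scheme M N L)

/-- Since answers are functions of queries and messages, a scheme is private as soon as the law of
each single query does not depend on the desired message. -/
lemma isPrivate_of_map_eval_eq
    (h : ∀ n i j, (S.queryLaw i).map (fun q => q n) = (S.queryLaw j).map (fun q => q n)) :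
    S.IsPrivate := by
  have key : ∀ n i, ((messageLaw M L).prod (S.queryLaw i)).map
      (fun ω => (ω.2 n, S.answer n (ω.2 n, ω.1), ω.1)) =
      ((messageLaw M L).prod ((S.queryLaw i).map (fun q => q n))).map
        (fun x => (x.2, S.answer n (x.2, x.1), x.1)) := by
    intro n i
    conv_rhs => rw [← Measure.map_id (μ := messageLaw M L)]
    rw [Measure.map_prod_map _ _ measurable_id (measurable_pi_apply n)]
    have hf : Measurable fun x : Messages M L × S.Query n => (x.2, S.answer n (x.2, x.1), x.1) :=
      measurable_snd.prodMk (((S.measurable_answer n).comp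
        (measurable_snd.prodMk measurable_fst)).prodMk measurable_fst)
    exact (Measure.map_map hf (measurable_id.prodMap (measurable_pi_apply n))).symm
  intro n i j
  rw [key, key, h n i j]

/-- If, for almost all queries, `D` recovers `W_i` from the channel output up to an error
probability of `ε` whatever the messages are, then its error probability is at most `ε`. -/
lemma errorProb_le (p : unitInterval) (i : Fin M) (D : Word S.t → Word L) {ε : ℝ} (hε : 0 ≤ ε)
    (h : ∀ᵐ q ∂(S.queryLaw i), ∀ w,
      (noiseLaw p S.t).real {z | D (S.answerSum q w + z) ≠ w i} ≤ ε) :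
    S.errorProb p i (fun o => D o.2) ≤ ε := by
  have hmeas : MeasurableSet {ω : S.Sample | D (S.channelOutput ω) ≠ ω.1.1 i} :=
    (measurableSet_eq_fun ((measurable_of_finite D).comp S.measurable_channelOutput)
      ((measurable_pi_apply i).comp measurable_fst.fst)).compl
  have h' : ∀ᵐ x ∂((messageLaw M L).prod (S.queryLaw i)),
      noiseLaw p S.t (Prod.mk x ⁻¹' {ω : S.Sample | D (S.channelOutput ω) ≠ ω.1.1 i}) ≤
        ENNReal.ofReal ε := by
    filter_upwards [Measure.quasiMeasurePreserving_snd.ae h] with x hx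
    refine (ENNReal.le_ofReal_iff_toReal_le (measure_ne_top _ _) hε).2 ?_
    simp only [channelOutput_eq]
    exact hx x.1
  refine ENNReal.toReal_le_of_le_ofReal hε ?_
  change S.law p i {ω : S.Sample | D (S.channelOutput ω) ≠ ω.1.1 i} ≤ _
  rw [law, Measure.prod_apply hmeas]
  exact (lintegral_mono_ae h').trans_eq (by simp)

end Scheme

/-- The uniform law on binary words. -/
noncomputable def uniformWord (m : ℕ) : Measure (Word m) :=
  (PMF.uniformOfFintype (Word m)).toMeasure

instance (m : ℕ) : IsProbabilityMeasure (uniformWord m) :=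
  inferInstanceAs (IsProbabilityMeasure (PMF.uniformOfFintype (Word m)).toMeasure)

lemma map_add_right_uniformWord {m : ℕ} (c : Word m) :
    (uniformWord m).map (fun a => a + c) = uniformWord m := by
  refine Measure.ext_of_singleton fun a => ?_
  have hpre : (fun a => a + c) ⁻¹' {a} = {a - c} := by
    ext b; simp only [Set.mem_preimage, Set.mem_singleton_iff, eq_sub_iff_add_eq]
  rw [Measure.map_apply (measurable_of_finite _) (measurableSet_singleton _), hpre, uniformWord,
    PMF.toMeasure_apply_singleton _ _ (measurableSet_singleton _),
    PMF.toMeasure_apply_singleton _ _ (measurableSet_singleton _)]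
  simp

/-- The queries with random part `a`: the first database gets `a`, the second one
`a + e_i`, and all others get `0`. -/
def queries {M N : ℕ} (hN : 2 ≤ N) (i : Fin M) (a : Word M) : Fin N → Word M :=
  (Pi.single (⟨0, by omega⟩ : Fin N) a : Fin N → Word M) +
    (Pi.single (⟨1, by omega⟩ : Fin N) (a + Pi.single i 1) : Fin N → Word M)

lemma sum_queries {M N : ℕ} (hN : 2 ≤ N) (i : Fin M) (a : Word M) :
    ∑ n, queries hN i a n = Pi.single i 1 := by
  simp only [queries, Pi.add_apply, Finset.sum_add_distrib, Finset.sum_pi_single', Finset.mem_univ,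
    if_true]
  have h : a + a = 0 := funext fun m => CharTwo.add_self_eq_zero (a m)
  rw [← add_assoc, h, zero_add]

/-- Each single query is uniform or zero, whatever message is desired. -/
lemma map_queries_eval {M N : ℕ} (hN : 2 ≤ N) (i j : Fin M) (n : Fin N) :
    (uniformWord M).map (fun a => queries hN i a n) =
      (uniformWord M).map (fun a => queries hN j a n) := by
  by_cases h0 : n = ⟨0, by omega⟩
  · subst h0
    simp [queries]
  by_cases h1 : n = ⟨1, by omega⟩
  · subst h1
    simp [queries, ← add_assoc, map_add_right_uniformWord]
  · simp [queries, h0, h1]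

/-- The two-server linear scheme over a code with generator matrix `G`: on a query `q` the
database encodes the combination `∑ m, q m • W_m` of the messages. Because the queries add up to
`e_i` and the code is linear, the channel adds up the answers to the codeword of `W_i`. -/
noncomputable def linearScheme {M N L t : ℕ} (hN : 2 ≤ N) (ht : 0 < t) (G : Fin L → Word t) :
    Scheme M N L where
  t := t
  t_pos := ht
  Query _ := Word M
  measurableSpaceQuery _ := inferInstance
  queryLaw i := (uniformWord M).map (queries hN i)
  isProbabilityMeasure_queryLaw _ :=
    Measure.isProbabilityMeasure_map (measurable_of_finite _).aemeasurable
  answer _ x := encode G (∑ m, x.1 m • x.2 m)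
  measurable_answer _ := measurable_of_finite _

lemma linearScheme_isPrivate {M N L t : ℕ} (hN : 2 ≤ N) (ht : 0 < t) (G : Fin L → Word t) :
    (linearScheme (M := M) hN ht G).IsPrivate := by
  refine Scheme.isPrivate_of_map_eval_eq _ fun n i j => ?_
  have h : ∀ i : Fin M, ((uniformWord M).map (queries hN i)).map (fun q => q n) =
      (uniformWord M).map (fun a => queries hN i a n) := fun i =>
    Measure.map_map (measurable_pi_apply n) (measurable_of_finite _)
  exact (h i).trans ((map_queries_eval hN i j n).trans (h j).symm)

lemma linearScheme_errorProb_le {M N L t : ℕ} (hN : 2 ≤ N) (ht : 0 < t) (G : Fin L → Word t)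
    (p : unitInterval) (i : Fin M) (D : Word t → Word L) {ε : ℝ} (hε : 0 ≤ ε)
    (h : ∀ x, (noiseLaw p t).real {z | D (encode G x + z) ≠ x} ≤ ε) :
    (linearScheme (M := M) hN ht G).errorProb p i (fun o => D o.2) ≤ ε := by
  refine Scheme.errorProb_le (linearScheme hN ht G) p i D hε ?_
  have hq : ∀ᵐ q ∂((uniformWord M).map (queries hN i)), ∑ n, q n = Pi.single i 1 :=
    (ae_map_iff (measurable_of_finite _).aemeasurable (Set.toFinite _).measurableSet).2
      (ae_of_all _ fun a => sum_queries hN i a)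
  change ∀ᵐ q ∂((uniformWord M).map (queries hN i)), _
  filter_upwards [hq] with q hq w
  have hsum : (linearScheme (M := M) hN ht G).answerSum q w = encode G (w i) := by
    change ∑ n, encode G (∑ m, q n m • w m) = _
    rw [← map_sum, Finset.sum_comm]
    congr 1
    have hm : ∀ m, ∑ n, q n m • w m = (Pi.single i 1 : Word M) m • w m := fun m => by
      rw [← hq, ← Finset.sum_smul, Finset.sum_apply]
    simp only [hm]
    rw [Finset.sum_eq_single i (fun m _ hm => by simp [hm]) (by simp)]
    simp
  rw [hsum]
  exact h (w i)

/-! ### The capacity -/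

lemma binaryEntropyBits_lt_one {p : unitInterval} (hp : (p : ℝ) < 1 / 2) :
    binaryEntropyBits p < 1 := by
  rw [binaryEntropyBits, div_lt_one (Real.log_pos one_lt_two)]
  exact Real.binEntropy_lt_log_two.2 (by rw [← one_div]; exact hp.ne)

/-- By Fano's inequality, a vanishing error probability makes the equivocation sublinear. -/
lemma errorAchievableRates_subset (M N : ℕ) (p : unitInterval) :
    errorAchievableRates M N p ⊆ entropyAchievableRates M N p := by
  rintro R ⟨S, hpriv, hdec, hR⟩
  refine ⟨S, hpriv, fun i => ?_, hR⟩
  obtain ⟨d, hd, herr⟩ := hdec i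
  have hlog : 0 < Real.log 2 := Real.log_pos one_lt_two
  have hle : ∀ L, (S L).equivocation p i ≤ 1 + (S L).errorProb p i (d L) * L := by
    intro L
    have h := condEntropy_le_fano ((S L).law p i) (X := fun ω => ω.1.1 i)
      ((measurable_pi_apply i).comp measurable_fst.fst) (S L).measurable_observation (hd L)
    rwa [card_word, Nat.cast_pow, Real.log_pow, Nat.cast_ofNat, mul_div_assoc,
      div_self hlog.ne', mul_one] at h
  have hnonneg : ∀ L, 0 ≤ (S L).equivocation p i := fun L =>
    div_nonneg (integral_nonneg fun y => Finset.sum_nonneg fun x _ =>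
      Real.negMulLog_nonneg measureReal_nonneg measureReal_le_one) hlog.le
  refine (isLittleO_iff_tendsto' ?_).2 ?_
  · filter_upwards [eventually_gt_atTop 0] with L hL h0
    exact absurd h0 (by positivity)
  · have hlim : Tendsto (fun L : ℕ => 1 / (L : ℝ) + (S L).errorProb p i (d L)) atTop (𝓝 0) := by
      simpa using tendsto_one_div_atTop_nhds_zero_nat.add herr
    refine tendsto_of_tendsto_of_tendsto_of_le_of_le' tendsto_const_nhds hlim
      (Eventually.of_forall fun L => div_nonneg (hnonneg L) (Nat.cast_nonneg L)) ?_
    filter_upwards [eventually_gt_atTop 0] with L hL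
    have hL' : (0 : ℝ) < L := Nat.cast_pos.2 hL
    rw [div_le_iff₀ hL', add_mul, one_div, inv_mul_cancel₀ hL'.ne']
    exact hle L

lemma le_of_mem_entropyAchievableRates {M N : ℕ} (hM : 1 ≤ M) {p : unitInterval} {R : ℝ}
    (hR : R ∈ entropyAchievableRates M N p) : R ≤ 1 - binaryEntropyBits p := by
  obtain ⟨S, -, he, hR⟩ := hR
  have he0 := (he ⟨0, hM⟩).tendsto_div_nhds_zero
  have hlim := hR.sub (he0.mul hR)
  rw [zero_mul, sub_zero] at hlim
  refine le_of_tendsto hlim ?_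
  filter_upwards [eventually_gt_atTop 0] with L hL
  have hL' : (0 : ℝ) < L := Nat.cast_pos.2 hL
  have ht : (0 : ℝ) < (S L).t := Nat.cast_pos.2 (S L).t_pos
  have h := (S L).le_equivocation p ⟨0, hM⟩
  rw [div_mul_div_cancel₀ hL'.ne', ← sub_div, div_le_iff₀ ht]
  linarith

lemma mem_errorAchievableRates (M : ℕ) {N : ℕ} (hN : 2 ≤ N) {p : unitInterval} {R : ℝ}
    (hR0 : 0 < R) (hR : R < 1 - binaryEntropyBits p) : R ∈ errorAchievableRates M N p := by
  obtain ⟨r, hr0, hr1, hcode⟩ := exists_code_of_lt_capacity p hR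
  set t : ℕ → ℕ := fun L => ⌈R⁻¹ * L⌉₊ + 1 with ht
  have htL : ∀ L : ℕ, R⁻¹ * L ≤ t L := fun L => by
    have := Nat.le_ceil (R⁻¹ * (L : ℝ))
    push_cast [ht]
    linarith
  choose G D hGD using fun L => hcode L (t L) (by
    have := mul_le_mul_of_nonneg_left (htL L) hR0.le
    rwa [mul_inv_cancel_left₀ hR0.ne'] at this)
  refine ⟨fun L => linearScheme hN (Nat.succ_pos _) (G L),
    fun L => linearScheme_isPrivate hN _ _,
    fun i => ⟨fun L o => D L o.2, fun L => (measurable_of_finite (D L)).comp measurable_snd, ?_⟩, ?_⟩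
  · have htop : Tendsto t atTop atTop := by
      refine (tendsto_natCast_atTop_iff (R := ℝ)).1 (tendsto_atTop_mono htL ?_)
      exact tendsto_natCast_atTop_atTop.const_mul_atTop (inv_pos.2 hR0)
    have hlim : Tendsto (fun L => 2 * r ^ t L) atTop (𝓝 0) := by
      simpa using ((tendsto_pow_atTop_nhds_zero_of_lt_one hr0 hr1).comp htop).const_mul 2
    exact squeeze_zero (fun L => measureReal_nonneg)
      (fun L => linearScheme_errorProb_le hN _ _ p i (D L) (by positivity) (hGD L)) hlim
  · have h1 : Tendsto (fun L : ℕ => (⌈R⁻¹ * (L : ℝ)⌉₊ : ℝ) / L + 1 / L) atTop (𝓝 (R⁻¹ + 0)) :=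
      ((tendsto_nat_ceil_mul_div_atTop (inv_nonneg.2 hR0.le)).comp
        tendsto_natCast_atTop_atTop).add tendsto_one_div_atTop_nhds_zero_nat
    have h2 := h1.inv₀ (by simpa using hR0.ne')
    rw [add_zero, inv_inv] at h2
    refine h2.congr fun L => ?_
    change _ = (L : ℝ) / (t L : ℝ)
    rw [← add_div, inv_div]
    push_cast [ht]
    rfl

end MACPIR

theorem mainTheorem4 (M N : ℕ) (hM : 1 ≤ M) (hN : 2 ≤ N) (p : unitInterval)
    (hp : (p : ℝ) < 1 / 2) :
    IsLUB (MACPIR.entropyAchievableRates M N p) (1 - MACPIR.binaryEntropyBits p) ∧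
      IsLUB (MACPIR.errorAchievableRates M N p) (1 - MACPIR.binaryEntropyBits p) := by
  have hsub := MACPIR.errorAchievableRates_subset M N p
  have hupper : 1 - MACPIR.binaryEntropyBits p ∈
      upperBounds (MACPIR.entropyAchievableRates M N p) :=
    fun R hR => MACPIR.le_of_mem_entropyAchievableRates hM hR
  have hlower : ∀ b ∈ upperBounds (MACPIR.errorAchievableRates M N p),
      1 - MACPIR.binaryEntropyBits p ≤ b := by
    intro b hb
    refine le_of_forall_lt_imp_le_of_dense fun c hc => ?_
    obtain ⟨R, hcR, hR⟩ := exists_between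
      (max_lt hc (sub_pos.2 (MACPIR.binaryEntropyBits_lt_one hp)))
    exact (le_max_left _ _).trans (hcR.le.trans (hb (MACPIR.mem_errorAchievableRates M hN
      ((le_max_right _ _).trans_lt hcR) hR)))
  exact ⟨⟨hupper, fun b hb => hlower b (upperBounds_mono_set hsub hb)⟩,
    ⟨upperBounds_mono_set hsub hupper, hlower⟩⟩
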